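/- All graphs are finite and simple. For natural numbers $m,l,\delta$ let $\mathcal{T}_{m,l+1}^{\delta}$ be the family of trees $T$ on $m$ vertices with bipartition $\{A,B\}$ such that $l+1=|A|\le |B|$ and $\delta=\min\{d_T(v):v\in A\}$. Put $t=m-1-(l+1)\delta$ and, for $v\in A$, $t_v=d_T(v)-\delta$. Let $J=\{v\in A:t_v>0\}$. Let $J_1$ consist of $J$ and of all vertices of $A$ that are interior vertices of a path of length more than $2$ in $T$ with both endpoints in $A$. Let $J_2\subseteq A$ be a set of smallest size containing $J_1$ such that no two vertices of $A\setminus J_2$ have a common neighbor, and let $J'\subseteq A$ be a set of smallest size containing $J_2$ such that no vertex of $A\setminus J'$ has common neighbors with two or more vertices of $J'$. For $v\in J'$ let $a_v$ be the number of vertices of $A\setminus J'$ at distance $2$ from $v$. For $I\subseteq J'$ let $T^I$ be the subgraph of $T$ induced by the vertices of $I$ and the vertices of all paths of length $2$ in $T$ with both endpoints in $I$. We say that $T$ satisfies the hypothesis (H) if there is a non-empty set $I\subseteq J'$ such that $T^I$ is a tree, $$\sum_{v\in I}a_v\ \ge\ 2+\sum_{v\in I}(t_v-1),$$ and, in case $|I|>1$,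 moreover $a_v\le t_v$ for every $v\in I$ and the set of all neighbors in $T$ of the vertices of $V(T^I)\setminus J'$ is exactly $I$. **Theorem.** Let $T\in\mathcal{T}_{m,l+1}^{\delta}$. Then $t<l$ if and only if $m<(l+1)(\delta+1)$. If $t<l$, then $T$ satisfies (H), for every choice of $J_2$ and $J'$ in the construction above, and $T$ can be embedded into $\overline{K}_l\vee mS_\delta$, that is, $\overline{K}_l\vee mS_\delta$ contains a subgraph isomorphic to $T$. Here $\overline{K}_l$ is the graph with $l$ vertices and no edges, $S_\delta=K_{1,\delta-1}$ is the star on $\delta$ vertices, $mS_\delta$ is the union of $m$ disjoint copies of it, and $G\vee H$ is the join (disjoint copies of $G$ and $H$ together with all edges between them). -/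

import Mathlib

namespace TreeEmbedding

/-- The join `G ∨ H`: disjoint copies of `G` and `H`, with every vertex of `G` joined to every
vertex of `H`. -/
def join {V W : Type*} (G : SimpleGraph V) (H : SimpleGraph W) : SimpleGraph (V ⊕ W) :=
  (G ⊕g H) ⊔ completeBipartiteGraph V W

/-- `k G`: the union of `k` pairwise disjoint copies of `G`. -/
def copies {V : Type*} (k : ℕ) (G : SimpleGraph V) : SimpleGraph (Fin k × V) where
  Adj x y := x.1 = y.1 ∧ G.Adj x.2 y.2
  symm := ⟨fun _ _ h => ⟨h.1.symm, h.2.symm⟩⟩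
  loopless := ⟨fun x h => G.loopless.irrefl x.2 h.2⟩

/-- The star `S_d = K_{1, d-1}` on `d` vertices (for `d ≥ 1`). -/
abbrev star (d : ℕ) : SimpleGraph (Fin 1 ⊕ Fin (d - 1)) :=
  completeBipartiteGraph (Fin 1) (Fin (d - 1))

/-- The graph `K̄_l ∨ m S_d`. -/
abbrev target (l m d : ℕ) : SimpleGraph (Fin l ⊕ (Fin m × (Fin 1 ⊕ Fin (d - 1)))) :=
  join (⊥ : SimpleGraph (Fin l)) (copies m (star d))

section
variable {V : Type*} [Fintype V] [DecidableEq V]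

/-- `T` is a tree on `m` vertices with bipartition `{A, Aᶜ}`, where `A` is the smaller part, has
`l + 1` vertices, and `δ` is the minimum degree in `T` of the vertices of `A`. -/
structure InFamily (T : SimpleGraph V) [DecidableRel T.Adj] (A : Finset V) (m l δ : ℕ) : Prop where
  isTree : T.IsTree
  card_eq : Fintype.card V = m
  bipartite : T.IsBipartiteWith (A : Set V) ((Aᶜ : Finset V) : Set V)
  card_le : A.card ≤ (Aᶜ : Finset V).card
  card_part : A.card = l + 1
  min_degree : IsLeast ((fun v => T.degree v) '' (A : Set V)) δ

/-- The excess degree `t_v = d_T(v) - δ`. -/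
def excess (T : SimpleGraph V) [DecidableRel T.Adj] (δ : ℕ) (v : V) : ℤ :=
  (T.degree v : ℤ) - (δ : ℤ)

/-- `J`: the vertices of `A` of positive excess. -/
def setJ (T : SimpleGraph V) [DecidableRel T.Adj] (A : Finset V) (δ : ℕ) : Set V :=
  {v | v ∈ A ∧ 0 < excess T δ v}

/-- `J₁`: the vertices of `J`, and the vertices of `A` that are interior vertices of a path of
length more than 2 with both ends in `A`. -/
def setJ1 (T : SimpleGraph V) [DecidableRel T.Adj] (A : Finset V) (δ : ℕ) : Set V :=
  setJ T A δ ∪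
    {v | v ∈ A ∧ ∃ x ∈ A, ∃ y ∈ A, ∃ p : T.Walk x y,
      p.IsPath ∧ 2 < p.length ∧ v ∈ p.support ∧ v ≠ x ∧ v ≠ y}

/-- `K` has the least number of elements among the sets between `S` and `A` with the
property `P`. -/
structure IsSmallestBetween (S : Set V) (A : Finset V) (P : Finset V → Prop) (K : Finset V) :
    Prop where
  le : S ⊆ (K : Set V)
  sub : K ⊆ A
  prop : P K
  min : ∀ L : Finset V, S ⊆ (L : Set V) → L ⊆ A → P L → K.card ≤ L.card

/-- No two vertices of `A \ K` have a common neighbour. -/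
def NoSharing (T : SimpleGraph V) (A K : Finset V) : Prop :=
  ∀ u ∈ A \ K, ∀ v ∈ A \ K, u ≠ v → ¬ (T.commonNeighbors u v).Nonempty

/-- No vertex of `A \ K` has common neighbours with two or more vertices of `K`. -/
def NoDoubleSharing (T : SimpleGraph V) (A K : Finset V) : Prop :=
  ∀ v ∈ A \ K, ∀ x ∈ K, ∀ y ∈ K,
    (T.commonNeighbors v x).Nonempty → (T.commonNeighbors v y).Nonempty → x = y

/-- `J'` is a possible outcome of the construction: for some smallest set `J₂` containing `J₁` such
that no two vertices of `A \ J₂` have a common neighbour, `J'` is a smallest set containing `J₂`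
such that no vertex of `A \ J'` has common neighbours with two or more vertices of `J'`. -/
def IsJPrime (T : SimpleGraph V) [DecidableRel T.Adj] (A : Finset V) (δ : ℕ) (J' : Finset V) :
    Prop :=
  ∃ J₂ : Finset V, IsSmallestBetween (setJ1 T A δ) A (NoSharing T A) J₂ ∧
    IsSmallestBetween (J₂ : Set V) A (NoDoubleSharing T A) J'

/-- `A_v`: the vertices of `A \ J'` at distance two from `v`; its size is `a_v`. -/
noncomputable def nearby (T : SimpleGraph V) (A J' : Finset V) (v : V) : Finset V :=
  (A \ J').filter fun u => T.dist v u = 2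

/-- The vertex set of `T^I`: the vertices of `I` and of all paths of length 2 from `I` to `I`. -/
def verts (T : SimpleGraph V) (I : Finset V) : Set V :=
  (I : Set V) ∪ {b | ∃ u ∈ I, ∃ w ∈ I, u ≠ w ∧ T.Adj u b ∧ T.Adj b w}

/-- The embedding hypothesis for `T` with the set `I ⊆ J'`. -/
structure HypothesisWith (T : SimpleGraph V) [DecidableRel T.Adj] (A : Finset V) (δ : ℕ)
    (J' I : Finset V) : Prop where
  sub : I ⊆ J'
  nonempty : I.Nonempty
  isTree : (T.induce (verts T I)).IsTree
  ineq : 2 + ∑ v ∈ I, (excess T δ v - 1) ≤ ∑ v ∈ I, ((nearby T A J' v).card : ℤ)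
  le_excess : 1 < I.card → ∀ v ∈ I, ((nearby T A J' v).card : ℤ) ≤ excess T δ v
  closed : 1 < I.card → {x | ∃ b ∈ verts T I \ (J' : Set V), T.Adj b x} = (I : Set V)

/-- `T` satisfies the embedding hypothesis, whichever choices are made in the construction
of `J'`. -/
def SatisfiesHypothesis (T : SimpleGraph V) [DecidableRel T.Adj] (A : Finset V) (δ : ℕ) : Prop :=
  ∀ J' : Finset V, IsJPrime T A δ J' → ∃ I : Finset V, HypothesisWith T A δ J' I

theorem exists_isSmallestBetween (S : Set V) (A : Finset V) (P : Finset V → Prop)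
    (hS : S ⊆ (A : Set V)) (hP : P A) : ∃ K, IsSmallestBetween S A P K := by
  classical
  obtain ⟨K, hK, hmin⟩ := Finset.exists_min_image
    (Finset.univ.filter fun L : Finset V => S ⊆ (L : Set V) ∧ L ⊆ A ∧ P L) Finset.card
    ⟨A, by simp [hS, hP]⟩
  simp only [Finset.mem_filter, Finset.mem_univ, true_and] at hK hmin
  exact ⟨K, hK.1, hK.2.1, hK.2.2, fun L h1 h2 h3 => hmin L ⟨h1, h2, h3⟩⟩

/-- The construction of `J'` always has an outcome. -/
theorem exists_isJPrime (T : SimpleGraph V) [DecidableRel T.Adj] (A : Finset V) (δ : ℕ) :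
    ∃ J', IsJPrime T A δ J' := by
  obtain ⟨J₂, h₂⟩ := exists_isSmallestBetween (setJ1 T A δ) A (NoSharing T A)
    (by rintro v (h | h) <;> exact h.1) (by intro u hu; simp at hu)
  obtain ⟨J', h'⟩ := exists_isSmallestBetween (J₂ : Set V) A (NoDoubleSharing T A)
    (by exact_mod_cast h₂.sub) (by intro u hu; simp at hu)
  exact ⟨J', J₂, h₂, h'⟩

end

end TreeEmbedding

namespace TreeEmbedding

/-! Everything rests on two edge counts: the excesses $t_v$ over $A$ sum to $t$, and $\deg b-1$ over
the other part sums to $l$. For (H): $J'$ contains every vertex of positive excess, and each vertex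
of $A\setminus J'$ is counted in exactly one $a_v$. Hence $\sum_{J'}a_v=l+1-|J'|\ge
2+\sum_{J'}(t_v-1)$ once $t<l$. If some $a_v>t_v$, take $I=\{v\}$; otherwise $I=J'$ works. The
embedding does not go through (H). Let $U\subseteq A$ be star centres and $Q$ removed vertices
outside $A$. If each $v\in U$ loses exactly $t_v+1$ neighbours to $Q$, it keeps $\delta-1$, which
with $v$ form a star $S_\delta$; the set $(A\setminus U)\cup Q$ goes to $\overline K_l$. Starting
from $U=A$, $Q=A^c$, branches of the tree are pruned until all losses are exact
(`IsStarChoice.exists_card_eq`); the preserved weight inequality then gives $|A\setminus U|+|Q|\le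
l$ (`IsStarChoice.card_add_card`). -/

open Finset

/-! ### The tree $T^{J'}$ and the hypothesis (H) -/

/-- A map to a set of vertices that is the identity on the set and sends edges to equal or adjacent
vertices shows that the set induces a connected subgraph. -/
theorem connected_induce_of_retraction {V : Type*} {G : SimpleGraph V} (hG : G.Connected)
    (s : Set V) (ρ : V → V) (hs : ∀ x, ρ x ∈ s) (hid : ∀ x ∈ s, ρ x = x)
    (hadj : ∀ x y, G.Adj x y → ρ x = ρ y ∨ G.Adj (ρ x) (ρ y)) : (G.induce s).Connected := by
  have key : ∀ x y, G.Walk x y → (G.induce s).Reachable ⟨ρ x, hs x⟩ ⟨ρ y, hs y⟩ := by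
    intro x y p
    induction p with
    | nil => exact SimpleGraph.Reachable.refl _
    | cons h p ih =>
      refine SimpleGraph.Reachable.trans ?_ ih
      rcases hadj _ _ h with h | h
      · simp only [h]
        exact SimpleGraph.Reachable.refl _
      · exact SimpleGraph.Adj.reachable (by simpa using h)
  have : Nonempty s := by
    obtain ⟨x⟩ := hG.nonempty
    exact ⟨⟨ρ x, hs x⟩⟩
  refine ⟨fun x y => ?_⟩
  obtain ⟨p⟩ := hG.preconnected x.1 y.1
  have := key _ _ p
  simpa only [hid _ x.2, hid _ y.2] using this

section
variable {V : Type*} {T : SimpleGraph V}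

theorem dist_eq_two_iff {A : Finset V} (hT : T.IsTree)
    (hA : ∀ x y, T.Adj x y → (x ∈ A ↔ y ∉ A)) {u v : V} (hu : u ∈ A) (hv : v ∈ A) (huv : u ≠ v) :
    T.dist u v = 2 ↔ (T.commonNeighbors u v).Nonempty := by
  constructor
  · intro h
    obtain ⟨p, hp⟩ := hT.connected.exists_walk_length_eq_dist u v
    rw [h] at hp
    match p, hp with
    | .cons h1 (.cons h2 .nil), _ => exact ⟨_, h1, h2.symm⟩
  · rintro ⟨b, h1, h2⟩
    have hle := SimpleGraph.dist_le (SimpleGraph.Walk.cons h1 (.cons h2.symm .nil))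
    have h0 : T.dist u v ≠ 0 := by
      rw [Ne, hT.connected.dist_eq_zero_iff]
      exact huv
    have h1 : T.dist u v ≠ 1 := by
      rw [Ne, SimpleGraph.dist_eq_one_iff_adj]
      intro h
      exact (hA u v h).1 hu hv
    change T.dist u v ≤ 2 at hle
    omega

theorem exists_commonNeighbor {A : Finset V} (hT : T.IsTree)
    (hA : ∀ x y, T.Adj x y → (x ∈ A ↔ y ∉ A)) (hc : 1 < A.card) {u : V} (hu : u ∈ A) :
    ∃ w ∈ A, w ≠ u ∧ (T.commonNeighbors u w).Nonempty := by
  obtain ⟨a, ha, hau⟩ := Finset.exists_mem_ne hc u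
  obtain ⟨p, hp, -⟩ := hT.existsUnique_path u a
  match p, hp with
  | .nil, _ => exact absurd rfl hau
  | .cons h .nil, _ => exact absurd ha ((hA _ _ h).1 hu)
  | .cons (v := b) h (.cons (v := w) h' q), hp =>
    refine ⟨w, ?_, ?_, ⟨b, h, h'.symm⟩⟩
    · have := hA _ _ h
      have := hA _ _ h'
      tauto
    · rintro rfl
      simp at hp

variable [DecidableEq V]

/-- The tree `T^{J'}` for a set `J'` such as those in the construction. -/
theorem isTree_induce_verts {A J : Finset V} (hT : T.IsTree)
    (hA : ∀ x y, T.Adj x y → (x ∈ A ↔ y ∉ A)) (hJA : J ⊆ A) (hJ : J.Nonempty)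
    (hc : 1 < A.card) (h1 : NoSharing T A J) (h2 : NoDoubleSharing T A J) :
    (T.induce (verts T J)).IsTree := by
  classical
  refine ⟨?_, hT.isAcyclic.induce _⟩
  -- The vertex of $A$ reached from $a$ in two steps lies in $J$ by `NoSharing`; `NoDoubleSharing`
  -- makes this parent unique.
  have hpar : ∀ a, ∃ u, a ∈ A \ J → u ∈ J ∧ (T.commonNeighbors a u).Nonempty := by
    intro a
    by_cases ha : a ∈ A \ J
    · obtain ⟨w, hw, hwa, hn⟩ := exists_commonNeighbor hT hA hc (mem_sdiff.1 ha).1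
      refine ⟨w, fun _ => ⟨?_, hn⟩⟩
      by_contra hwJ
      exact h1 a ha w (mem_sdiff.2 ⟨hw, hwJ⟩) hwa.symm hn
    · exact ⟨a, fun h => absurd h ha⟩
  choose par hpar using hpar
  have hJv : ∀ u ∈ J, u ∈ verts T J := fun u hu => Or.inl (by exact_mod_cast hu)
  obtain ⟨j₀, hj₀⟩ := hJ
  -- The retraction onto $T^J$: vertices of $A\setminus J$ go to their parent, and a vertex outside
  -- both $A$ and $T^J$ goes to its neighbour in $J$ or to the parent of its neighbour in
  -- $A\setminus J$. The default `j₀` serves only vertices with no neighbour in $A$.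
  have hρ : ∀ x, ∃ s ∈ verts T J, (x ∈ verts T J → s = x) ∧ (x ∈ A \ J → s = par x) ∧
      (x ∉ A → x ∉ verts T J → (∀ u ∈ J, T.Adj u x → s = u) ∧
        ∀ a ∈ A \ J, T.Adj a x → s = par a) := by
    intro x
    by_cases hx : x ∈ verts T J
    · refine ⟨x, hx, fun _ => rfl, fun hxA => ?_, fun _ h => absurd hx h⟩
      rcases hx with hx | ⟨u, hu, w, hw, huw, h, h'⟩
      · exact absurd (by exact_mod_cast hx) (mem_sdiff.1 hxA).2
      · exact absurd (mem_sdiff.1 hxA).1 ((hA _ _ h).1 (hJA hu))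
    by_cases hxA : x ∈ A
    · have hxJ : x ∈ A \ J := mem_sdiff.2 ⟨hxA, fun h => hx (hJv x h)⟩
      exact ⟨par x, hJv _ (hpar x hxJ).1, fun h => absurd h hx, fun _ => rfl,
        fun h => absurd hxA h⟩
    by_cases hu : ∃ u ∈ J, T.Adj u x
    · obtain ⟨u, hu, hux⟩ := hu
      refine ⟨u, hJv u hu, fun h => absurd h hx, fun h => absurd (mem_sdiff.1 h).1 hxA,
        fun _ _ => ⟨fun w hw hwx => ?_, fun a ha hax => ?_⟩⟩
      · by_contra huw
        exact hx (Or.inr ⟨u, hu, w, hw, huw, hux, hwx.symm⟩)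
      · exact h2 a ha u hu _ (hpar a ha).1 ⟨x, hax, hux⟩ (hpar a ha).2
    by_cases ha : ∃ a ∈ A \ J, T.Adj a x
    · obtain ⟨a, ha, hax⟩ := ha
      refine ⟨par a, hJv _ (hpar a ha).1, fun h => absurd h hx,
        fun h => absurd (mem_sdiff.1 h).1 hxA,
        fun _ _ => ⟨fun w hw hwx => absurd ⟨w, hw, hwx⟩ hu, fun a' ha' hax' => ?_⟩⟩
      by_contra hne
      refine h1 a ha a' ha' (fun h => hne (by rw [h])) ⟨x, hax, hax'⟩
    · exact ⟨j₀, hJv _ hj₀, fun h => absurd h hx, fun h => absurd (mem_sdiff.1 h).1 hxA,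
        fun _ _ => ⟨fun w hw hwx => absurd ⟨w, hw, hwx⟩ hu,
          fun w hw hwx => absurd ⟨w, hw, hwx⟩ ha⟩⟩
  choose ρ hs hid hρA hρB using hρ
  have hadjA : ∀ x y, T.Adj x y → x ∈ A → ρ x = ρ y ∨ T.Adj (ρ x) (ρ y) := by
    intro x y hxy hx
    have hy := (hA x y hxy).1 hx
    by_cases hyv : y ∈ verts T J
    · by_cases hxJ : x ∈ J
      · right
        rwa [hid x (hJv x hxJ), hid y hyv]
      · exfalso
        rcases hyv with hyv | ⟨u, hu, w, hw, huw, h, h'⟩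
        · exact hy (hJA (by exact_mod_cast hyv))
        · exact huw (h2 x (mem_sdiff.2 ⟨hx, hxJ⟩) u hu w hw ⟨y, hxy, h⟩ ⟨y, hxy, h'.symm⟩)
    · left
      by_cases hxJ : x ∈ J
      · rw [hid x (hJv x hxJ), (hρB y hy hyv).1 x hxJ hxy]
      · have hxJ' := mem_sdiff.2 ⟨hx, hxJ⟩
        rw [hρA x hxJ', (hρB y hy hyv).2 x hxJ' hxy]
  refine connected_induce_of_retraction hT.connected _ ρ hs hid fun x y hxy => ?_
  by_cases hx : x ∈ A
  · exact hadjA x y hxy hx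
  · rcases hadjA y x hxy.symm (by by_contra hy; exact hx ((hA x y hxy).2 hy)) with h | h
    · exact Or.inl h.symm
    · exact Or.inr h.symm

/-- Every vertex of `A \ J'` is at distance two from exactly one vertex of `J'`. -/
theorem sum_card_nearby {A J : Finset V} (hT : T.IsTree)
    (hA : ∀ x y, T.Adj x y → (x ∈ A ↔ y ∉ A)) (hJA : J ⊆ A)
    (hc : 1 < A.card) (h1 : NoSharing T A J) (h2 : NoDoubleSharing T A J) :
    ∑ v ∈ J, (nearby T A J v).card = (A \ J).card := by
  classical
  have hdc := sum_card_bipartiteAbove_eq_sum_card_bipartiteBelow (s := J) (t := A \ J)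
    (fun v u => T.dist v u = 2)
  have hone : ∀ u ∈ A \ J, (bipartiteBelow (fun v u => T.dist v u = 2) J u).card = 1 := by
    intro u hu
    have hu' := mem_sdiff.1 hu
    obtain ⟨w, hw, hwu, hn⟩ := exists_commonNeighbor hT hA hc hu'.1
    have hwJ : w ∈ J := by
      by_contra hwJ
      exact h1 u hu w (mem_sdiff.2 ⟨hw, hwJ⟩) hwu.symm hn
    rw [card_eq_one]
    refine ⟨w, ?_⟩
    ext x
    simp only [bipartiteBelow, mem_filter, mem_singleton]
    have hne : ∀ x ∈ J, u ≠ x := fun x hx h => hu'.2 (h ▸ hx)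
    constructor
    · rintro ⟨hx, hd⟩
      rw [SimpleGraph.dist_comm, dist_eq_two_iff hT hA hu'.1 (hJA hx) (hne x hx)] at hd
      exact h2 u hu x hx w hwJ hd hn
    · rintro rfl
      refine ⟨hwJ, ?_⟩
      rwa [SimpleGraph.dist_comm, dist_eq_two_iff hT hA hu'.1 hw hwu.symm]
  rw [sum_congr rfl hone] at hdc
  simp only [sum_const, smul_eq_mul, mul_one] at hdc
  rw [← hdc]
  rfl

variable [Fintype V]

/-- For $I=\{v\}$ the inequality reads $t_v+1\le a_v$, and the conditions for $|I|>1$ are vacuous.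
-/
theorem hypothesisWith_singleton [DecidableRel T.Adj] {A J : Finset V} {δ : ℕ} {v : V} (hv : v ∈ J)
    (h : excess T δ v < ((nearby T A J v).card : ℤ)) : HypothesisWith T A δ J {v} where
  sub := by simpa using hv
  nonempty := by simp
  isTree := by
    have : verts T {v} = {v} := by
      ext x
      simp only [verts, mem_singleton, Set.mem_union, Set.mem_ofPred_eq]
      constructor
      · rintro (h | ⟨u, rfl, w, rfl, h, -⟩)
        · simpa using h
        · exact absurd rfl h
      · intro h
        left
        simpa using h
    rw [this]
    exact SimpleGraph.IsTree.of_subsingleton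
  ineq := by
    simp only [sum_singleton]
    omega
  le_excess := by simp
  closed := by simp

theorem hypothesisWith_self [DecidableRel T.Adj] {A J : Finset V} {δ : ℕ} (hT : T.IsTree)
    (hA : ∀ x y, T.Adj x y → (x ∈ A ↔ y ∉ A)) (hJA : J ⊆ A) (hJ : J.Nonempty)
    (hc : 1 < A.card) (h1 : NoSharing T A J) (h2 : NoDoubleSharing T A J)
    (hineq : 2 + ∑ v ∈ J, (excess T δ v - 1) ≤ ∑ v ∈ J, ((nearby T A J v).card : ℤ))
    (hle : ∀ v ∈ J, ((nearby T A J v).card : ℤ) ≤ excess T δ v) : HypothesisWith T A δ J J where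
  sub := subset_rfl
  nonempty := hJ
  isTree := isTree_induce_verts hT hA hJA hJ hc h1 h2
  ineq := hineq
  le_excess := fun _ => hle
  closed := by
    intro hJc
    ext x
    simp only [Set.mem_ofPred_eq, mem_coe]
    constructor
    · rintro ⟨b, ⟨hb | ⟨u, hu, w, hw, huw, h, h'⟩, hbJ⟩, hbx⟩
      · exact absurd hb hbJ
      · by_contra hxJ
        have hxA : x ∈ A := by
          have := hA _ _ h
          have := hA _ _ hbx
          have := hJA hu
          tauto
        exact huw (h2 x (mem_sdiff.2 ⟨hxA, hxJ⟩) u hu w hw ⟨b, hbx.symm, h⟩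
          ⟨b, hbx.symm, h'.symm⟩)
    · intro hx
      -- The first step of a walk inside $T^J$ from $x$ to another vertex of $J$ gives the required
      -- $b$.
      obtain ⟨y, hy, hyx⟩ := Finset.exists_mem_ne hJc x
      have hcon := (isTree_induce_verts hT hA hJA hJ hc h1 h2).connected
      obtain ⟨p⟩ := hcon.preconnected ⟨x, Or.inl (by exact_mod_cast hx)⟩
        ⟨y, Or.inl (by exact_mod_cast hy)⟩
      cases p with
      | nil => exact absurd rfl hyx
      | @cons _ b _ hb q =>
        have hb' : T.Adj x b.1 := by simpa using hb
        refine ⟨b.1, ⟨b.2, fun hbJ => ?_⟩, hb'.symm⟩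
        exact (hA _ _ hb').1 (hJA hx) (hJA (by exact_mod_cast hbJ))

end

/-! ### Branches and pruning of star choices -/

/-- In a tree, the vertices other than `v` are sorted into branches: `r x` is the neighbour of `v`
on the path from `v` to `x`. -/
theorem exists_branch {V : Type*} {T : SimpleGraph V} (hT : T.IsTree) (v : V) :
    ∃ r : V → V, r v = v ∧ (∀ x, x ≠ v → T.Adj v (r x)) ∧ (∀ b, T.Adj v b → r b = b) ∧
      ∀ x y, x ≠ v → y ≠ v → T.Adj x y → r x = r y := by
  classical
  choose p hp hup using fun x => hT.existsUnique_path v x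
  -- For adjacent $x,y$, one of the paths from $v$ extends the other by the edge $xy$.
  have hstep : ∀ x y, x ≠ v → ∀ h : T.Adj x y, x ∈ (p y).support → (p x).snd = (p y).snd := by
    intro x y hx h hmem
    rw [hT.isAcyclic.path_concat (hp x) (hp y) h hmem]
    cases hq : p x with
    | nil => exact absurd rfl hx
    | cons h' q => simp [SimpleGraph.Walk.concat_cons]
  refine ⟨fun x => (p x).snd, ?_, ?_, ?_, ?_⟩
  · have : p v = SimpleGraph.Walk.nil := (hup v _ SimpleGraph.Walk.IsPath.nil).symm
    simp [this]
  · intro x hx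
    exact (p x).adj_snd (SimpleGraph.Walk.not_nil_of_ne hx.symm)
  · intro b hb
    have : p b = SimpleGraph.Walk.cons hb SimpleGraph.Walk.nil :=
      (hup b _ (by simp [hb.ne])).symm
    simp [this]
  · intro x y hx hy h
    by_cases hmem : x ∈ (p y).support
    · exact hstep x y hx h hmem
    · exact (hstep y x hy h.symm
        (hT.isAcyclic.mem_support_of_ne_mem_support_of_adj_of_isPath (hp x) (hp y) h hmem)).symm

section
variable {V : Type*} [Fintype V] [DecidableEq V]

/-- A choice of star centres `U ⊆ A` and of removed vertices `Q` outside `A`, such that every vertex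
outside `A` that is not removed has at most one neighbour in `U`, and every `v ∈ U` loses more than
`t v` neighbours. The last condition keeps the number of removed vertices small when these losses
are as small as possible. -/
structure IsStarChoice (T : SimpleGraph V) [DecidableRel T.Adj] (A : Finset V) (t : V → ℤ)
    (U Q : Finset V) : Prop where
  sub : U ⊆ A
  not_mem : ∀ b ∈ Q, b ∉ A
  closed : ∀ b ∈ Q, ∀ a, T.Adj b a → a ∈ U
  unique : ∀ b, b ∉ A → b ∉ Q → ∀ a ∈ U, ∀ a' ∈ U, T.Adj b a → T.Adj b a' → a = a'
  lt_card : ∀ v ∈ U, t v + 1 ≤ ((T.neighborFinset v ∩ Q).card : ℤ)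
  weight : 1 + ∑ v ∈ U, t v ≤ ∑ b ∈ Q, ((T.degree b : ℤ) - 1)

variable {T : SimpleGraph V} [DecidableRel T.Adj] {A : Finset V} {t : V → ℤ} {U Q : Finset V}

/-- Removing a branch at `v` from a star choice. -/
theorem IsStarChoice.prune (h : IsStarChoice T A t U Q) {v b : V} {β : Finset V}
    (hb : b ∉ A)
    (hβ : ∀ x y, T.Adj x y → x ∈ β → y ∉ β → x = b ∧ y = v)
    (hcard : b ∈ Q → t v + 2 ≤ ((T.neighborFinset v ∩ Q).card : ℤ))
    (hw : 1 + ∑ v ∈ U \ β, t v ≤ ∑ b ∈ Q \ β, ((T.degree b : ℤ) - 1)) :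
    IsStarChoice T A t (U \ β) (Q \ β) where
  sub := sdiff_subset.trans h.sub
  not_mem := fun b' hb' => h.not_mem b' (mem_sdiff.1 hb').1
  closed := by
    intro b' hb' a ha
    rw [mem_sdiff] at hb' ⊢
    have haU := h.closed b' hb'.1 a ha
    refine ⟨haU, fun haβ => hb ?_⟩
    rw [← (hβ a b' ha.symm haβ hb'.2).1]
    exact h.sub haU
  unique := by
    intro b' hb'A hb' a ha a' ha' hadj hadj'
    rw [mem_sdiff] at ha ha'
    by_cases hb'Q : b' ∈ Q
    · have hb'β : b' ∈ β := by
        by_contra hc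
        exact hb' (mem_sdiff.2 ⟨hb'Q, hc⟩)
      rw [(hβ _ _ hadj hb'β ha.2).2, (hβ _ _ hadj' hb'β ha'.2).2]
    · exact h.unique b' hb'A hb'Q a ha.1 a' ha'.1 hadj hadj'
  lt_card := by
    intro u hu
    rw [mem_sdiff] at hu
    have key : ∀ x ∈ T.neighborFinset u ∩ Q, x ∈ β → x = b ∧ u = v := by
      intro x hx hxβ
      rw [mem_inter, SimpleGraph.mem_neighborFinset] at hx
      exact hβ x u hx.1.symm hxβ hu.2
    by_cases hc : b ∈ Q ∧ u = v
    · obtain ⟨hbQ, rfl⟩ := hc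
      have hsub : (T.neighborFinset u ∩ Q).erase b ⊆ T.neighborFinset u ∩ (Q \ β) := by
        intro x hx
        rw [mem_erase] at hx
        have := key x hx.2
        grind
      have h1 := card_le_card hsub
      have h2 := pred_card_le_card_erase (s := T.neighborFinset u ∩ Q) (a := b)
      have := hcard hbQ
      omega
    · have hsub : T.neighborFinset u ∩ Q ⊆ T.neighborFinset u ∩ (Q \ β) := by
        intro x hx
        have := key x hx
        grind
      have := card_le_card hsub
      have := h.lt_card u hu.1
      omega
  weight := hw

/-- Take $|U|+|Q|$ minimal and suppose $v$ loses at least $t_v+2$ neighbours. Every branch at $v$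
that meets $U\cup Q$ is then too heavy to prune, and adding up the branch weights gives more than
the total. -/
theorem IsStarChoice.exists_card_eq (hT : T.IsTree)
    (hA : ∀ x y, T.Adj x y → (x ∈ A ↔ y ∉ A)) (ht : ∀ v ∈ A, 0 ≤ t v)
    (h : IsStarChoice T A t U Q) :
    ∃ U' Q', IsStarChoice T A t U' Q' ∧
      ∀ v ∈ U', ((T.neighborFinset v ∩ Q').card : ℤ) = t v + 1 := by
  induction hn : U.card + Q.card using Nat.strong_induction_on generalizing U Q with
  | _ n ih =>
  subst hn
  by_contra hcon
  have hmin : ∀ U' Q', IsStarChoice T A t U' Q' → U.card + Q.card ≤ U'.card + Q'.card := by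
    intro U' Q' h'
    by_contra hlt
    exact hcon (ih _ (not_le.1 hlt) h' rfl)
  obtain ⟨v, hvU, hv⟩ : ∃ v ∈ U, t v + 2 ≤ ((T.neighborFinset v ∩ Q).card : ℤ) := by
    by_contra! hall
    exact hcon ⟨U, Q, h, fun v hv => by have := h.lt_card v hv; have := hall v hv; omega⟩
  have hvA := h.sub hvU
  have hvQ : v ∉ Q := fun hc => h.not_mem v hc hvA
  obtain ⟨r, hrv, hr, hrb, hradj⟩ := exists_branch hT v
  set q : V → ℤ := fun b => (T.degree b : ℤ) - 1 with hq
  set W : V → ℤ := fun b => ∑ x ∈ Q with r x = b, q x - ∑ x ∈ U with r x = b, t x with hW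
  set N := T.neighborFinset v with hN
  have hsum : ∑ x ∈ Q, q x - ∑ x ∈ U, t x = - t v + ∑ b ∈ N, W b := by
    have h1 : ∑ b ∈ N, ∑ x ∈ Q with r x = b, q x = ∑ x ∈ Q, q x :=
      sum_fiberwise_of_maps_to (fun x hx => by
        rw [hN, SimpleGraph.mem_neighborFinset]
        exact hr x (fun hc => hvQ (hc ▸ hx))) _
    have h2 : ∑ b ∈ N, ∑ x ∈ U.erase v with r x = b, t x = ∑ x ∈ U.erase v, t x :=
      sum_fiberwise_of_maps_to (fun x hx => by
        rw [hN, SimpleGraph.mem_neighborFinset]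
        exact hr x (ne_of_mem_erase hx)) _
    have h3 : ∑ b ∈ N, ∑ x ∈ U with r x = b, t x = ∑ b ∈ N, ∑ x ∈ U.erase v with r x = b, t x := by
      refine sum_congr rfl fun b hb => ?_
      congr 1
      ext x
      rw [hN, SimpleGraph.mem_neighborFinset] at hb
      have := hb.ne
      simp only [mem_filter, mem_erase]
      refine ⟨fun hx => ⟨⟨fun hc => ?_, hx.1⟩, hx.2⟩, fun hx => ⟨hx.1.2, hx.2⟩⟩
      rw [hc, hrv] at hx
      exact this hx.2
    have h4 := add_sum_erase U t hvU
    simp only [hW, sum_sub_distrib]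
    rw [h1, h3, h2]
    linarith
  -- With $S=\sum_Q q-\sum_U t\ge 1$, a branch with $W(b)\le S-1$ could be pruned, contradicting
  -- minimality. So every branch meeting $U\cup Q$ has $W(b)\ge S$.
  have hprune : ∀ b ∈ N, (∃ x, (x ∈ Q ∨ x ∈ U) ∧ r x = b) →
      1 + ∑ x ∈ U, t x + W b ≤ ∑ x ∈ Q, q x → False := by
    rintro b hb ⟨z, hz, hzb⟩ hle
    rw [hN, SimpleGraph.mem_neighborFinset] at hb
    have hdiff : ∀ S : Finset V, S \ univ.filter (fun x => r x = b) = S.filter (fun x => ¬ r x = b) := by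
      intro S; ext x; simp
    have h' := h.prune (v := v) (b := b) (β := univ.filter fun x => r x = b)
      ((hA _ _ hb).1 hvA) (by
        intro x y hxy hx hy
        simp only [mem_filter, mem_univ, true_and] at hx hy
        have hxv : x ≠ v := by
          rintro rfl
          exact hb.ne (hrv.symm.trans hx)
        have hyv : y = v := by
          by_contra hyv
          exact hy ((hradj x y hxv hyv hxy).symm.trans hx)
        subst hyv
        exact ⟨(hrb x hxy.symm).symm.trans hx, rfl⟩) (fun _ => hv) (by
        have e1 := sum_filter_add_sum_filter_not U (fun x => r x = b) t
        have e2 := sum_filter_add_sum_filter_not Q (fun x => r x = b) q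
        rw [hdiff, hdiff]
        simp only [hW] at hle
        simp only [hq] at *
        linarith)
    have hm := hmin _ _ h'
    rw [hdiff, hdiff] at hm
    have c1 := card_filter_add_card_filter_not (s := U) (fun x => r x = b)
    have c2 := card_filter_add_card_filter_not (s := Q) (fun x => r x = b)
    rcases hz with hz | hz
    · have : 0 < (Q.filter fun x => r x = b).card := card_pos.2 ⟨z, by simp [hz, hzb]⟩
      omega
    · have : 0 < (U.filter fun x => r x = b).card := card_pos.2 ⟨z, by simp [hz, hzb]⟩
      omega
  have hw := h.weight
  have hWQ : ∀ b ∈ N ∩ Q, ∑ x ∈ Q, q x - ∑ x ∈ U, t x ≤ W b := by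
    intro b hb
    rw [mem_inter] at hb
    by_contra hc
    refine hprune b hb.1 ⟨b, Or.inl hb.2, hrb b ?_⟩ (by linarith [not_le.1 hc, Int.add_one_le_iff.2 (not_le.1 hc)])
    simpa [hN] using hb.1
  have hW0 : ∀ b ∈ N, 0 ≤ W b := by
    intro b hb
    by_contra hc
    have hc' := not_le.1 hc
    refine hprune b hb ?_ (by simp only [hq] at *; linarith)
    by_contra! hne
    apply hc
    simp only [hW]
    rw [filter_false_of_mem fun x hx => hne x (Or.inl hx),
      filter_false_of_mem fun x hx => hne x (Or.inr hx)]
    simp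
  obtain ⟨x, hx⟩ : (N ∩ Q).Nonempty := by
    rw [← card_pos]
    have := ht v hvA
    omega
  have e := add_sum_erase N W (mem_inter.1 hx).1
  -- One branch contributes $S$ and at least $t_v+1$ others contribute at least $1$ each, so
  -- $S=-t_v+\sum_b W(b)\ge S+1$.
  have hge : (((N ∩ Q).erase x).card : ℤ) ≤ ∑ b ∈ N.erase x, W b := by
    calc (((N ∩ Q).erase x).card : ℤ) = ∑ b ∈ (N ∩ Q).erase x, 1 := by simp
      _ ≤ ∑ b ∈ (N ∩ Q).erase x, W b := by
          refine sum_le_sum fun b hb => ?_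
          have := hWQ b (mem_of_mem_erase hb)
          simp only [hq] at *
          linarith
      _ ≤ ∑ b ∈ N.erase x, W b := by
          refine sum_le_sum_of_subset_of_nonneg (erase_subset_erase _ inter_subset_left) ?_
          intro b hb _
          exact hW0 b (mem_of_mem_erase hb)
  rw [card_erase_of_mem hx] at hge
  have := hWQ x hx
  have hpos := card_pos.2 ⟨x, hx⟩
  have : (((N ∩ Q).card - 1 : ℕ) : ℤ) = ((N ∩ Q).card : ℤ) - 1 := by omega
  linarith

/-- All neighbours of $Q$ lie in $U$, so counting the edges between $U$ and $Q$ gives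
$\sum_U(t_v+1)=\sum_Q\deg b$. The weight inequality then becomes $|Q|+1\le|U|$. -/
theorem IsStarChoice.card_add_card (h : IsStarChoice T A t U Q)
    (hc : ∀ v ∈ U, ((T.neighborFinset v ∩ Q).card : ℤ) = t v + 1) :
    (A \ U).card + Q.card < A.card := by
  have hdc : ∑ v ∈ U, (T.neighborFinset v ∩ Q).card = ∑ b ∈ Q, T.degree b := by
    have := sum_card_bipartiteAbove_eq_sum_card_bipartiteBelow (s := U) (t := Q) T.Adj
    convert this using 2 with v hv b hb
    · congr 1
      ext x
      simp [bipartiteAbove, and_comm]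
    · rw [← SimpleGraph.card_neighborFinset_eq_degree]
      congr 1
      ext x
      simp only [bipartiteBelow, SimpleGraph.mem_neighborFinset, mem_filter]
      exact ⟨fun hx => ⟨h.closed b hb x hx, hx.symm⟩, fun hx => hx.2.symm⟩
  have h1 : ∑ v ∈ U, (t v + 1) = ∑ b ∈ Q, (T.degree b : ℤ) := by
    rw [← sum_congr rfl hc]
    exact_mod_cast hdc
  have h2 := h.weight
  rw [sum_add_distrib] at h1
  rw [sum_sub_distrib] at h2
  simp only [sum_const, nsmul_eq_mul, mul_one] at h1 h2
  have h3 := card_sdiff_add_card_eq_card h.sub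
  omega

/-! ### From star choices to embeddings -/

theorem isContained_target {m l δ : ℕ} (hm : Fintype.card V = m)
    (hA : ∀ x y, T.Adj x y → (x ∈ A ↔ y ∉ A)) (hU : U ⊆ A) (hQ : ∀ b ∈ Q, b ∉ A)
    (hclosed : ∀ b ∈ Q, ∀ a, T.Adj b a → a ∈ U)
    (hunique : ∀ b, b ∉ A → b ∉ Q → ∀ a ∈ U, ∀ a' ∈ U, T.Adj b a → T.Adj b a' → a = a')
    (hl : (A \ U).card + Q.card ≤ l)
    (hδ : ∀ v ∈ U, (T.neighborFinset v \ Q).card ≤ δ - 1) :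
    T.IsContained (target l m δ) := by
  classical
  let idx : V ≃ Fin m := Fintype.equivFinOfCardEq hm
  let L := (A \ U) ∪ Q
  have hL : Fintype.card L ≤ Fintype.card (Fin l) := by
    simpa using (card_union_le _ _).trans hl
  obtain ⟨e⟩ := Function.Embedding.nonempty_of_card_le hL
  have hg : ∀ v ∈ U, Nonempty ((T.neighborFinset v \ Q : Finset V) ↪ Fin (δ - 1)) := by
    intro v hv
    apply Function.Embedding.nonempty_of_card_le
    rw [Fintype.card_coe, Fintype.card_fin]
    exact hδ v hv
  let g : ∀ v ∈ U, (T.neighborFinset v \ Q : Finset V) ↪ Fin (δ - 1) := fun v hv => (hg v hv).some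
  -- Stars are indexed by the vertices of $T$. A vertex outside `L` is a leaf in the star of its
  -- neighbour in $U$, if it has one, and otherwise the centre of its own star.
  let φ : V → Fin l ⊕ (Fin m × (Fin 1 ⊕ Fin (δ - 1))) := fun x =>
    if hx : x ∈ L then Sum.inl (e ⟨x, hx⟩)
    else if hv : ∃ v ∈ U, x ∉ A ∧ x ∈ T.neighborFinset v \ Q then
      Sum.inr (idx hv.choose,
        Sum.inr (g hv.choose hv.choose_spec.1 ⟨x, hv.choose_spec.2.2⟩))
    else Sum.inr (idx x, Sum.inl 0)
  have hφL : ∀ x (hx : x ∈ L), φ x = Sum.inl (e ⟨x, hx⟩) := fun x hx => by simp only [φ, dif_pos hx]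
  have hφleaf : ∀ x v (hv : v ∈ U) (hx : x ∈ T.neighborFinset v \ Q), x ∉ A →
      φ x = Sum.inr (idx v, Sum.inr (g v hv ⟨x, hx⟩)) := by
    intro x v hv hx hxA
    have hex : ∃ v ∈ U, x ∉ A ∧ x ∈ T.neighborFinset v \ Q := ⟨v, hv, hxA, hx⟩
    have hxL : x ∉ L := by simp only [L]; grind
    have hch : hex.choose = v := by
      have h1 := hex.choose_spec
      have h2 := hx
      rw [mem_sdiff, SimpleGraph.mem_neighborFinset] at h1 h2
      exact hunique x hxA h2.2 _ h1.1 _ hv h1.2.2.1.symm h2.1.symm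
    have hsame : ∀ w (hw : w ∈ U) (hxw : x ∈ T.neighborFinset w \ Q), w = v →
        (Sum.inr (idx w, Sum.inr (g w hw ⟨x, hxw⟩)) : Fin l ⊕ (Fin m × (Fin 1 ⊕ Fin (δ - 1)))) =
          Sum.inr (idx v, Sum.inr (g v hv ⟨x, hx⟩)) := by
      intro w hw hxw hwv
      subst hwv
      rfl
    simp only [φ, dif_neg hxL, dif_pos hex]
    exact hsame _ hex.choose_spec.1 hex.choose_spec.2.2 hch
  have hφc : ∀ x, x ∉ L → (¬ ∃ v ∈ U, x ∉ A ∧ x ∈ T.neighborFinset v \ Q) →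
      φ x = Sum.inr (idx x, Sum.inl 0) := fun x hx hx' => by
    simp only [φ, dif_neg hx, dif_neg hx']
  have hφU : ∀ v ∈ U, φ v = Sum.inr (idx v, Sum.inl 0) := by
    intro v hv
    have := hU hv
    refine hφc v ?_ ?_
    · simp only [L]; grind
    · rintro ⟨u, -, h, -⟩
      exact h this
  have hinj : Function.Injective φ := by
    intro x y hxy
    have tri : ∀ x, (x ∈ L) ∨ (∃ v, ∃ _ : v ∈ U, ∃ _ : x ∈ T.neighborFinset v \ Q, x ∉ A) ∨
        (x ∉ L ∧ ¬ ∃ v ∈ U, x ∉ A ∧ x ∈ T.neighborFinset v \ Q) := by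
      intro x
      by_cases h1 : x ∈ L
      · exact Or.inl h1
      · by_cases h2 : ∃ v ∈ U, x ∉ A ∧ x ∈ T.neighborFinset v \ Q
        · obtain ⟨v, hv, h3, h4⟩ := h2
          exact Or.inr (Or.inl ⟨v, hv, h4, h3⟩)
        · exact Or.inr (Or.inr ⟨h1, h2⟩)
    rcases tri x with hx | ⟨v, hv, hx, hxA⟩ | ⟨hx, hx'⟩ <;>
    rcases tri y with hy | ⟨w, hw, hy, hyA⟩ | ⟨hy, hy'⟩
    · rw [hφL x hx, hφL y hy] at hxy
      simpa using hxy
    · rw [hφL x hx, hφleaf y w hw hy hyA] at hxy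
      simp at hxy
    · rw [hφL x hx, hφc y hy hy'] at hxy
      simp at hxy
    · rw [hφleaf x v hv hx hxA, hφL y hy] at hxy
      simp at hxy
    · rw [hφleaf x v hv hx hxA, hφleaf y w hw hy hyA] at hxy
      simp only [Sum.inr.injEq, Prod.mk.injEq, EmbeddingLike.apply_eq_iff_eq] at hxy
      obtain ⟨rfl, hxy⟩ := hxy
      simpa using hxy
    · rw [hφleaf x v hv hx hxA, hφc y hy hy'] at hxy
      simp at hxy
    · rw [hφc x hx hx', hφL y hy] at hxy
      simp at hxy
    · rw [hφc x hx hx', hφleaf y w hw hy hyA] at hxy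
      simp at hxy
    · rw [hφc x hx hx', hφc y hy hy'] at hxy
      simpa using hxy
  have hmapA : ∀ x y, T.Adj x y → x ∈ A → (target l m δ).Adj (φ x) (φ y) := by
    intro x y hxy hx
    have hy := (hA x y hxy).1 hx
    by_cases hxU : x ∈ U
    · rw [hφU x hxU]
      by_cases hyQ : y ∈ Q
      · rw [hφL y (mem_union_right _ hyQ)]
        simp [target, join]
      · rw [hφleaf y x hxU (by simp [hxy, hyQ]) hy]
        simp [target, join, copies, star]
    -- Neighbours of $A\setminus U$ avoid $Q$, so no edge falls inside $\overline K_l$.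
    · have hyQ : y ∉ Q := fun hc => hxU (hclosed y hc x hxy.symm)
      obtain ⟨z, hz⟩ : ∃ z, φ y = Sum.inr z := by
        have hyL : y ∉ L := by simp [L, hy, hyQ]
        simp only [φ, dif_neg hyL]
        split_ifs <;> exact ⟨_, rfl⟩
      rw [hφL x (mem_union_left _ (by simp [hx, hxU])), hz]
      simp [target, join]
  refine ⟨⟨⟨φ, ?_⟩, hinj⟩⟩
  intro x y hxy
  by_cases hx : x ∈ A
  · exact hmapA x y hxy hx
  · exact (hmapA y x hxy.symm (by by_contra hy; exact hx ((hA x y hxy).2 hy))).symm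

end

/-! ### Degree counts and the two conclusions -/

section
variable {V : Type*} [Fintype V] [DecidableEq V] {T : SimpleGraph V} [DecidableRel T.Adj]
  {A : Finset V} {m l δ : ℕ}

theorem InFamily.mem_iff (h : InFamily T A m l δ) (x y : V) (hxy : T.Adj x y) :
    x ∈ A ↔ y ∉ A := by
  have := h.bipartite.mem_of_adj hxy
  simp only [mem_coe, mem_compl] at this
  tauto

theorem InFamily.excess_nonneg (h : InFamily T A m l δ) {v : V} (hv : v ∈ A) :
    0 ≤ excess T δ v := by
  have : δ ≤ T.degree v := h.min_degree.2 ⟨v, by exact_mod_cast hv, rfl⟩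
  simp only [excess]
  omega

theorem InFamily.card_edgeFinset (h : InFamily T A m l δ) : T.edgeFinset.card + 1 = m := by
  rw [h.isTree.card_edgeFinset, h.card_eq]

theorem InFamily.sum_excess (h : InFamily T A m l δ) :
    ∑ v ∈ A, excess T δ v = (m : ℤ) - 1 - ((l : ℤ) + 1) * (δ : ℤ) := by
  have h1 := SimpleGraph.isBipartiteWith_sum_degrees_eq_card_edges h.bipartite
  have h2 := h.card_edgeFinset
  have h3 : ∑ v ∈ A, (T.degree v : ℤ) = T.edgeFinset.card := by exact_mod_cast h1
  simp only [excess, sum_sub_distrib, sum_const, nsmul_eq_mul, h.card_part, h3]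
  push_cast
  omega

theorem InFamily.sum_compl_degree_sub_one (h : InFamily T A m l δ) :
    ∑ b ∈ Aᶜ, ((T.degree b : ℤ) - 1) = l := by
  have h1 := SimpleGraph.isBipartiteWith_sum_degrees_eq_card_edges' h.bipartite
  have h2 := h.card_edgeFinset
  have h3 : ∑ v ∈ Aᶜ, (T.degree v : ℤ) = T.edgeFinset.card := by exact_mod_cast h1
  have h4 := card_add_card_compl A
  rw [h.card_part, h.card_eq] at h4
  simp only [sum_sub_distrib, sum_const, nsmul_eq_mul, h3]
  omega

theorem InFamily.satisfiesHypothesis (h : InFamily T A m l δ)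
    (ht : (m : ℤ) - 1 - ((l : ℤ) + 1) * (δ : ℤ) < (l : ℤ)) : SatisfiesHypothesis T A δ := by
  rintro J ⟨J₂, hJ₂, hJ⟩
  have hsum := h.sum_excess
  have hnn : 0 ≤ ∑ v ∈ A, excess T δ v := sum_nonneg fun v hv => h.excess_nonneg hv
  have hc : 1 < A.card := by
    rw [h.card_part]
    omega
  have hsub : J₂ ⊆ J := by exact_mod_cast hJ.le
  have h1 : NoSharing T A J := fun u hu v hv =>
    hJ₂.prop u (sdiff_subset_sdiff subset_rfl hsub hu) v (sdiff_subset_sdiff subset_rfl hsub hv)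
  have hnb := sum_card_nearby h.isTree h.mem_iff hJ.sub hc h1 hJ.prop
  have hz : ∑ v ∈ A \ J, excess T δ v = 0 := by
    refine sum_eq_zero fun v hv => ?_
    rw [mem_sdiff] at hv
    by_contra hne
    have hpos : 0 < excess T δ v := lt_of_le_of_ne (h.excess_nonneg hv.1) (Ne.symm hne)
    exact hv.2 (hsub (by exact_mod_cast hJ₂.le (Or.inl ⟨hv.1, hpos⟩)))
  have hsplit := sum_sdiff hJ.sub (f := excess T δ)
  have hcard := card_sdiff_add_card_eq_card hJ.sub
  rw [h.card_part] at hcard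
  have hineq : 2 + ∑ v ∈ J, (excess T δ v - 1) ≤ ∑ v ∈ J, ((nearby T A J v).card : ℤ) := by
    rw [← Nat.cast_sum, hnb, sum_sub_distrib]
    simp only [sum_const, nsmul_eq_mul, mul_one]
    omega
  by_cases hex : ∃ v ∈ J, excess T δ v < ((nearby T A J v).card : ℤ)
  · obtain ⟨v, hv, hlt⟩ := hex
    exact ⟨{v}, hypothesisWith_singleton hv hlt⟩
  · push Not at hex
    refine ⟨J, hypothesisWith_self h.isTree h.mem_iff hJ.sub ?_ hc h1 hJ.prop hineq hex⟩
    rw [nonempty_iff_ne_empty]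
    rintro rfl
    simp at hineq

theorem InFamily.isContained (h : InFamily T A m l δ)
    (ht : (m : ℤ) - 1 - ((l : ℤ) + 1) * (δ : ℤ) < (l : ℤ)) : T.IsContained (target l m δ) := by
  have hsum := h.sum_excess
  have hnn : 0 ≤ ∑ v ∈ A, excess T δ v := sum_nonneg fun v hv => h.excess_nonneg hv
  -- Needed because `δ - 1` is truncated, and because each $v\in A$ initially loses $t_v+\delta\ge
  -- t_v+1$ neighbours.
  have hδ : 1 ≤ δ := by
    obtain ⟨v, hv, hvδ⟩ := h.min_degree.1
    have hc : 1 < A.card := by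
      rw [h.card_part]
      omega
    obtain ⟨w, -, hwv⟩ := Finset.exists_mem_ne hc v
    have : Nontrivial V := ⟨w, v, hwv⟩
    have := h.isTree.connected.preconnected.degree_pos_of_nontrivial v
    simp only at hvδ
    omega
  -- For this initial choice the weight condition is $1+t\le l$, the only place where the bound on
  -- $t$ limits the size of the image in $\overline K_l$.
  have h0 : IsStarChoice T A (excess T δ) A Aᶜ :=
    { sub := subset_rfl
      not_mem := fun b hb => mem_compl.1 hb
      closed := fun b hb a hab => by
        by_contra ha
        exact mem_compl.1 hb ((h.mem_iff b a hab).2 ha)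
      unique := fun b hb hb' => absurd (mem_compl.2 hb) hb'
      lt_card := fun v hv => by
        have : T.neighborFinset v ∩ Aᶜ = T.neighborFinset v := by
          rw [inter_eq_left]
          intro x hx
          exact mem_compl.2 ((h.mem_iff v x (by simpa using hx)).1 hv)
        rw [this, SimpleGraph.card_neighborFinset_eq_degree]
        simp only [excess]
        omega
      weight := by
        rw [h.sum_compl_degree_sub_one]
        omega }
  obtain ⟨U, Q, hUQ, hcard⟩ := h0.exists_card_eq h.isTree h.mem_iff fun v hv => h.excess_nonneg hv
  have hl := hUQ.card_add_card hcard
  rw [h.card_part] at hl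
  refine isContained_target h.card_eq h.mem_iff hUQ.sub hUQ.not_mem hUQ.closed hUQ.unique
    (by omega) fun v hv => ?_
  have h1 := hcard v hv
  have h2 := card_sdiff_add_card_inter (T.neighborFinset v) Q
  rw [SimpleGraph.card_neighborFinset_eq_degree] at h2
  simp only [excess] at h1
  omega

end

end TreeEmbedding

theorem corollary2p9 {V : Type*} [Fintype V] [DecidableEq V] (T : SimpleGraph V)
    [DecidableRel T.Adj] (A : Finset V) (m l δ : ℕ)
    (hT : TreeEmbedding.InFamily T A m l δ) :
    ((m : ℤ) - 1 - ((l : ℤ) + 1) * (δ : ℤ) < (l : ℤ) ↔ m < (l + 1) * (δ + 1)) ∧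
    ((m : ℤ) - 1 - ((l : ℤ) + 1) * (δ : ℤ) < (l : ℤ) →
      TreeEmbedding.SatisfiesHypothesis T A δ ∧
      T.IsContained (TreeEmbedding.target l m δ)) := by
  refine ⟨?_, fun ht => ⟨hT.satisfiesHypothesis ht, hT.isContained ht⟩⟩
  zify
  constructor <;> intro h <;> linarith
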